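/- **Setting.** Let $m\in\mathbb N$, let $\le$ be the componentwise order on $\mathbb R^m$, and let $BU$ be the set of bounded uniformly continuous functions $x:(-\infty,0]\to\mathbb R^m$. For a function $z$ defined up to time $t$, write $z_t(s)=z(t+s)$, $s\le 0$. Consider a compartmental system given by positive Borel measures $\mu_{ij},\nu_{ij}$ on $(-\infty,0]$ ($1\le i,j\le m$), continuous transport functions $\widetilde g_{ij}:\mathbb R\times\mathbb R\to\mathbb R$ ($0\le i\le m$, $1\le j\le m$) and inflows $\widetilde I_i:\mathbb R\to[0,\infty)$, regarded as components $\widetilde g_{i0}(t,v)=\widetilde I_i(t)$ of $\widetilde g=(\widetilde g_{ij})$ that do not depend on $v$. Assume: * (C1) $\widetilde g$ is $C^1$-admissible: all its components are $C^1$ in $v$, and $\widetilde g$ and $\partial\widetilde g/\partial v$ are, for each $v_0\in\mathbb R$, bounded on $\mathbb R\times\{v_0\}$ and uniformly continuous there, in the sense that continuity at the points $(t,v_0)$, as functions on $\mathbb R^2$, is uniform in $t\in\mathbb R$ (for all $v_0$ together: they are bounded and uniformly continuous on $\mathbb R\times K$ for every compact $K\subset\mathbb R$). All components are nondecreasing in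 $v$, and $\widetilde g_{ij}(t,0)=0$ for all $t$, $0\le i\le m$, $1\le j\le m$. * (C2) $\widetilde g$ is recurrent: its hull $\Omega$, the closure of $\{\widetilde g_t: t\in\mathbb R\}$, $\widetilde g_t(s,v)=\widetilde g(t+s,v)$, for uniform convergence on compact sets, is minimal for the translation flow $(\omega{\cdot}t)(s,v)=\omega(t+s,v)$ (i.e. $\Omega$ is compact, invariant, and its only nonempty compact invariant subset is $\Omega$). * (C3) $\mu_{ij}(-\infty,0]=1$ and $\int_{-\infty}^0|s|\,d\mu_{ij}(s)<\infty$. * (C4) $\nu_{ij}(\{0\})=0$ and $\sum_{j=1}^m\nu_{ij}(-\infty,0]<1$ for each $i$. * (C5) With $c_{ij}=\inf_{\mathbb R^2}\partial\widetilde g_{ij}/\partial v$ and $d_{ij}=\sup_{\mathbb R^2}\partial\widetilde g_{ij}/\partial v\in[0,\infty]$, the measures $c_{ij}\,\mu_{ij}-\sum_{k=0}^m d_{ki}\,\nu_{ij}$, $1\le i,j\le m$, are positive, i.e. $\sum_{k=0}^m d_{ki}\,\nu_{ij}\le c_{ij}\,\mu_{ij}$ (with $\infty\cdot 0=0$). Put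 $D_ix=x_i(0)-\sum_{j=1}^m\int_{-\infty}^0x_j(s)\,d\nu_{ij}(s)$, $g_{ij}(\omega,v)=\omega_{ij}(0,v)$, $I_i(\omega)=\omega_{i0}(0,\cdot)$ and, for $\omega\in\Omega$, $x\in BU$, $$F_i(\omega,x)=-g_{0i}(\omega,x_i(0))-\sum_{j=1}^m g_{ji}(\omega,x_i(0))+\sum_{j=1}^m\int_{-\infty}^0 g_{ij}(\omega{\cdot}s,x_j(s))\,d\mu_{ij}(s)+I_i(\omega).$$ For $x,y\in BU$ write $x\le_D y$ if $Dx_s\le Dy_s$ for all $s\le 0$, and let $BU_D^+=\{x\in BU: Dx_s\ge 0\text{ for all }s\le0\}$. A solution of $\frac{d}{dt}Dz_t=F(\omega{\cdot}t,z_t)$ on $[0,b)$, $0<b\le\infty$, with initial value $x\in BU$ is a function $z=z(\cdot,\omega,x)$, continuous on $(-\infty,b)$, with $z_0=x$, such that $t\mapsto Dz_t$ is differentiable on $[0,b)$ (from the right at $0$) and satisfies the equation there. **Proposition.** Under (C1)–(C5): * (F4) If $x,y\in BU$, $x\le_D y$ and $D_jx=D_jy$ for some $j\in\{1,\dots,m\}$,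 then $F_j(\omega,x)\le F_j(\omega,y)$ for every $\omega\in\Omega$. * (F5) If $x,y\in BU$, $x\le_D y$ and $D_ix<D_iy$ for some $i\in\{1,\dots,m\}$, then $D_iz_t(\omega,x)<D_iz_t(\omega,y)$ for every $\omega\in\Omega$ and all $t\ge0$ for which both solutions are defined. * $\Omega\times BU_D^+$ is positively invariant: if $\omega\in\Omega$, $x\in BU_D^+$, then $(\omega{\cdot}t,z_t(\omega,x))\in\Omega\times BU_D^+$ for all $t\ge0$ for which the solution is defined. -/

import Mathlib

open Set Filter Topology MeasureTheory

noncomputable section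

namespace NFDE

/-! ### Histories, the space `BU`, and abstract neutral equations -/

/-- Functions `(-∞, 0] → ℝᵐ`; on `Fin m → ℝ` the norm is the maximum norm and `≤` is the
componentwise order. -/
abbrev Hist (m : ℕ) : Type := Iic (0 : ℝ) → Fin m → ℝ

/-- The bounded uniformly continuous functions `(-∞, 0] → ℝᵐ`. -/
def BU (m : ℕ) : Set (Hist m) :=
  {x | (∃ C : ℝ, ∀ s, ‖x s‖ ≤ C) ∧ UniformContinuous x}

/-- The value at `0` of a history. -/
def at0 {m : ℕ} (x : Hist m) : Fin m → ℝ := x ⟨0, self_mem_Iic⟩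

/-- For `x : (-∞, 0] → ℝᵐ` and `s ≤ 0`, the history `x_s`, that is `x_s(θ) = x(s + θ)`. -/
def shift {m : ℕ} (x : Hist m) (s : Iic (0 : ℝ)) : Hist m :=
  fun θ => x ⟨s.1 + θ.1, mem_Iic.2 (add_nonpos s.2 θ.2)⟩

/-- For a function `z` of real time, the history `z_t`, that is `z_t(θ) = z(t + θ)`, `θ ≤ 0`. -/
def segment {m : ℕ} (z : ℝ → Fin m → ℝ) (t : ℝ) : Hist m := fun θ => z (t + θ.1)

/-- The order `x ≤_D y`: `D x_s ≤ D y_s` for all `s ≤ 0`. -/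
def LeD {m : ℕ} (D : Hist m → Fin m → ℝ) (x y : Hist m) : Prop :=
  ∀ s, D (shift x s) ≤ D (shift y s)

/-- The positive cone `BU_D⁺ = {x ∈ BU | D x_s ≥ 0 for all s ≤ 0}`. -/
def BUDPos {m : ℕ} (D : Hist m → Fin m → ℝ) : Set (Hist m) :=
  {x | x ∈ BU m ∧ ∀ s, 0 ≤ D (shift x s)}

/-- `z` solves `d/dt D z_t = F(ω·t, z_t)` on `[0, b)`, `0 < b ≤ ∞`, with initial value `x`:
it is continuous on `(-∞, b)`, equals `x` on `(-∞, 0]`, and `t ↦ D z_t` has the derivative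
`F(ω·t, z_t)` at every `t ∈ [0, b)` (the right derivative at `t = 0`).
The values of `z` at times `≥ b` play no role. -/
structure IsSolution {m : ℕ} {W : Type*} (flow : ℝ → W → W) (D : Hist m → Fin m → ℝ)
    (F : W → Hist m → Fin m → ℝ) (w : W) (x : Hist m) (b : EReal)
    (z : ℝ → Fin m → ℝ) : Prop where
  pos : 0 < b
  continuousOn : ContinuousOn z {t : ℝ | (t : EReal) < b}
  initial : segment z 0 = x
  equation : ∀ t : ℝ, 0 ≤ t → (t : EReal) < b →
    HasDerivWithinAt (fun r : ℝ => D (segment z r)) (F (flow t w) (segment z t)) (Ici 0) t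

/-- The quasimonotonicity condition (F4). -/
def Quasimonotone {m : ℕ} {W : Type*} (Ω : Set W) (D : Hist m → Fin m → ℝ)
    (F : W → Hist m → Fin m → ℝ) : Prop :=
  ∀ x ∈ BU m, ∀ y ∈ BU m, LeD D x y → ∀ j : Fin m, D x j = D y j →
    ∀ w ∈ Ω, F w x j ≤ F w y j

/-- The componentwise separating property (F5), for as long as the solutions with initial
values `x` and `y` are both defined. -/
def ComponentwiseSeparating {m : ℕ} {W : Type*} (Ω : Set W) (flow : ℝ → W → W)
    (D : Hist m → Fin m → ℝ) (F : W → Hist m → Fin m → ℝ) : Prop :=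
  ∀ x ∈ BU m, ∀ y ∈ BU m, LeD D x y → ∀ i : Fin m, D x i < D y i →
    ∀ w ∈ Ω, ∀ (b : EReal) (zx zy : ℝ → Fin m → ℝ),
      IsSolution flow D F w x b zx → IsSolution flow D F w y b zy →
        ∀ t : ℝ, 0 ≤ t → (t : EReal) < b → D (segment zx t) i < D (segment zy t) i

/-- Positive invariance of a set of pairs `(ω, x)` under the local skew-product semiflow
`(t, ω, x) ↦ (ω·t, z_t(ω, x))`. -/
def PositivelyInvariant {m : ℕ} {W : Type*} (flow : ℝ → W → W)
    (D : Hist m → Fin m → ℝ) (F : W → Hist m → Fin m → ℝ) (S : Set (W × Hist m)) : Prop :=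
  ∀ w x, (w, x) ∈ S → ∀ (b : EReal) (z : ℝ → Fin m → ℝ), IsSolution flow D F w x b z →
    ∀ t : ℝ, 0 ≤ t → (t : EReal) < b → (flow t w, segment z t) ∈ S

/-! ### Translation flow, hull, minimality, admissibility -/

/-- The translation `ω ↦ ω·t`, `ω·t (s, v) = ω (t + s, v)`. -/
def translate {E : Type*} [TopologicalSpace E] (t : ℝ) (w : C(ℝ × ℝ, E)) : C(ℝ × ℝ, E) :=
  ⟨fun p => w (t + p.1, p.2), by fun_prop⟩

/-- The hull: the closure of the set of translates, for uniform convergence on compact sets. -/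
def hull {E : Type*} [TopologicalSpace E] (g : C(ℝ × ℝ, E)) : Set C(ℝ × ℝ, E) :=
  closure (range fun t : ℝ => translate t g)

/-- A minimal set of a flow: compact, invariant, and its only nonempty compact invariant
subset is itself. -/
def IsMinimalSet {W : Type*} [TopologicalSpace W] (flow : ℝ → W → W) (M : Set W) : Prop :=
  IsCompact M ∧ (∀ t, flow t '' M = M) ∧
    ∀ N ⊆ M, N.Nonempty → IsCompact N → (∀ t, flow t '' N = N) → N = M

/-- `f` is bounded on the line `ℝ × {v₀}` and uniformly continuous there, i.e. its continuity
at the points `(t, v₀)` is uniform in `t`. (For all `v₀` together this says that `f` is bounded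
and uniformly continuous on `ℝ × K` for every compact set `K`.) -/
def BddUnifContAlong (f : ℝ → ℝ → ℝ) (v₀ : ℝ) : Prop :=
  (∃ C : ℝ, ∀ t, |f t v₀| ≤ C) ∧
    ∀ ε > 0, ∃ δ > 0, ∀ t t' v' : ℝ, |t' - t| < δ → |v' - v₀| < δ → |f t' v' - f t v₀| < ε

/-! ### Compartmental systems -/

/-- Index set of the `m (m + 2)` components of `g`. `Sum.inl (k, j)` is the component `g_{kj}`,
the transport from compartment `j` to compartment `k` (`k = none` is the environment `C₀`), and
`Sum.inr i` is the component `g_{i0} = I_i`, the inflow from the environment into `i`. -/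
abbrev Flux (m : ℕ) : Type := (Option (Fin m) × Fin m) ⊕ Fin m

/-- The data of a compartmental system with `m` compartments: transport functions and inflows
(collected in `g`), transit time distributions `μ i j` and production measures `ν i j`.
The inflows are nonnegative functions of time only. -/
structure Compartmental (m : ℕ) where
  g : C(ℝ × ℝ, Flux m → ℝ)
  μ : Fin m → Fin m → Measure (Iic (0 : ℝ))
  ν : Fin m → Fin m → Measure (Iic (0 : ℝ))
  inflow_time_only : ∀ (i : Fin m) (t v : ℝ), g (t, v) (Sum.inr i) = g (t, 0) (Sum.inr i)
  inflow_nonneg : ∀ (i : Fin m) (t v : ℝ), 0 ≤ g (t, v) (Sum.inr i)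

namespace Compartmental

variable {m : ℕ} (S : Compartmental m)

/-- The component `c` of `g` as a function of `t` and `v`. -/
def comp (c : Flux m) (t v : ℝ) : ℝ := S.g (t, v) c

/-- The partial derivative in `v` of the component `c` of `g`. -/
def dcomp (c : Flux m) (t v : ℝ) : ℝ := deriv (fun u => S.comp c t u) v

/-- (C1): `g` is `C¹`-admissible, its components are nondecreasing in `v`, and the transport
functions vanish at `v = 0`. -/
def C1 : Prop :=
  (∀ c t, ContDiff ℝ 1 (fun v => S.comp c t v)) ∧
  (∀ c v₀, BddUnifContAlong (S.comp c) v₀ ∧ BddUnifContAlong (S.dcomp c) v₀) ∧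
  (∀ c t, Monotone (fun v => S.comp c t v)) ∧
  (∀ k j t, S.comp (Sum.inl (k, j)) t 0 = 0)

/-- (C2): `g` is recurrent, i.e. its hull is minimal for the translation flow. -/
def C2 : Prop := IsMinimalSet translate (hull S.g)

/-- (C3): the `μ i j` have total mass one and finite first moment. -/
def C3 : Prop :=
  ∀ i j, S.μ i j univ = 1 ∧ Integrable (fun s : Iic (0 : ℝ) => |(s : ℝ)|) (S.μ i j)

/-- (C4): `ν i j` has no mass at `0`, and `∑ⱼ ν i j (-∞, 0] < 1` for each `i`. -/
def C4 : Prop :=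
  (∀ i j, S.ν i j {⟨0, self_mem_Iic⟩} = 0) ∧ ∀ i, ∑ j, S.ν i j univ < 1

/-- `c_{ij}`, the infimum of `∂g_{ij}/∂v` over `ℝ²` (these derivatives are nonnegative). -/
def cInf (k : Option (Fin m)) (j : Fin m) : ENNReal :=
  ⨅ p : ℝ × ℝ, ENNReal.ofReal (S.dcomp (Sum.inl (k, j)) p.1 p.2)

/-- `d_{ij}`, the supremum of `∂g_{ij}/∂v` over `ℝ²`, possibly `∞`. -/
def dSup (k : Option (Fin m)) (j : Fin m) : ENNReal :=
  ⨆ p : ℝ × ℝ, ENNReal.ofReal (S.dcomp (Sum.inl (k, j)) p.1 p.2)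

/-- (C5): the measures `c_{ij} μ_{ij} - ∑_{k=0}^m d_{ki} ν_{ij}` are positive
(with `∞ · 0 = 0`, so an infinite `d_{ki}` forces `ν_{ij} = 0`). -/
def C5 : Prop :=
  ∀ i j : Fin m, (∑ k : Option (Fin m), S.dSup k i) • S.ν i j ≤ S.cInf (some i) j • S.μ i j

/-- The operator `D_i x = x_i(0) - ∑ⱼ ∫ x_j dν_{ij}`. -/
def D (x : Hist m) (i : Fin m) : ℝ := at0 x i - ∑ j, ∫ s, x s j ∂(S.ν i j)

/-- The hull `Ω` of `g`. -/
def Ω : Set C(ℝ × ℝ, Flux m → ℝ) := hull S.g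

/-- The maps `g_{kj}(ω, v) = ω_{kj}(0, v)` on the hull. -/
def gHull (k : Option (Fin m)) (j : Fin m) (w : C(ℝ × ℝ, Flux m → ℝ)) (v : ℝ) : ℝ :=
  w (0, v) (Sum.inl (k, j))

/-- The inflow `I_i(ω)` on the hull. -/
def inflow (i : Fin m) (w : C(ℝ × ℝ, Flux m → ℝ)) : ℝ := w (0, 0) (Sum.inr i)

/-- The right-hand side `F_i(ω, x) = - g_{0i}(ω, x_i(0)) - ∑ⱼ g_{ji}(ω, x_i(0))
+ ∑ⱼ ∫ g_{ij}(ω·s, x_j(s)) dμ_{ij}(s) + I_i(ω)`. -/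
def F (w : C(ℝ × ℝ, Flux m → ℝ)) (x : Hist m) (i : Fin m) : ℝ :=
  - gHull none i w (at0 x i) - ∑ j, gHull (some j) i w (at0 x i)
    + ∑ j, ∫ s : Iic (0 : ℝ), gHull (some i) j (translate (s : ℝ) w) (x s j) ∂(S.μ i j)
    + inflow i w

end Compartmental

end NFDE

end

open Set Filter Topology MeasureTheory

noncomputable section

namespace NFDE

/-! ### A differential inequality -/

/-! Everything rests on one estimate: if `y - x ≥ -V` with `V ≥ 0`, then `F_i(y) - F_i(x) ≥ -K (V +
(D_i y - D_i x)⁺)`, with `K` uniform on bounded sets of histories (`exists_F_lower_bound`). The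
outflow increment is at most `∑ₖ d_{ki} (y_i(0) - x_i(0))⁺`, and `y_i(0) - x_i(0)` is `D_i(y - x)`
plus integrals against `ν_{ij}`. By (C5) the integral part costs no more than `∑ⱼ c_{ij} ∫ (y_j -
x_j)⁺ dμ_{ij}`, which the increment of the transport integrals supplies, up to an error of order
`V`. Infinite `d_{ki}` are cut off at a local Lipschitz constant.

By (C4) the operator `D` has a positive inverse: a lower bound `-P` for `D` along all past shifts
gives a lower bound `-C P` for the history (`C4.exists_lower_bound`). For `P = 0` this turns `≤_D`
into `≤`, and the estimate with `V = 0` is (F4).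

For solutions, `p(t) = D y_t - D x_t` then satisfies a delay differential inequality which keeps it
nonnegative. Hence `V = 0` is admissible at all times, `p_i' ≥ -K p_i`, and a positive `p_i` stays
positive: this is (F5). Positive invariance is the same comparison with the zero function, a
subsolution because the inflows are nonnegative. -/

/-- First-touching argument against the barrier `-ε exp((K + 1) t)`. The barrier moves downwards, so
its depth `P` at the first touching time bounds the negative part of the whole past, as `hf`
requires. -/
theorem nonneg_of_hasDerivWithinAt_of_lower_bound {m : ℕ} {p f : ℝ → Fin m → ℝ} {T K : ℝ}
    (hK : 0 ≤ K) (hp : ∀ s ≤ 0, ∀ i, 0 ≤ p s i)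
    (hd : ∀ t ∈ Icc 0 T, ∀ i, HasDerivWithinAt (fun r => p r i) (f t i) (Ici 0) t)
    (hf : ∀ t ∈ Icc 0 T, ∀ P, 0 ≤ P → (∀ s ≤ t, ∀ j, -P ≤ p s j) →
      ∀ i, -(K * (P + max (p t i) 0)) ≤ f t i) :
    ∀ t ≤ T, ∀ i, 0 ≤ p t i := by
  have hcont : ∀ i, ContinuousOn (fun r => p r i) (Icc 0 T) := fun i t ht =>
    ((hd t ht i).continuousWithinAt).mono Icc_subset_Ici_self
  have key : ∀ ε > 0, ∀ t ∈ Icc 0 T, ∀ i, 0 < p t i + ε * Real.exp ((K + 1) * t) := by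
    intro ε hε
    by_contra! hcon
    obtain ⟨t₀, ht₀, i₀, hi₀⟩ := hcon
    set B : Set ℝ := ⋃ i, Icc 0 T ∩ (fun t => p t i + ε * Real.exp ((K + 1) * t)) ⁻¹' Iic 0
    have hBc : IsCompact B := by
      refine isCompact_iUnion fun i => ?_
      refine isCompact_Icc.of_isClosed_subset ?_ inter_subset_left
      refine ContinuousOn.preimage_isClosed_of_isClosed ?_ isClosed_Icc isClosed_Iic
      exact (hcont i).add (by fun_prop)
    obtain ⟨t₁, ht₁, hmin⟩ := hBc.exists_isLeast ⟨t₀, mem_iUnion.2 ⟨i₀, ht₀, hi₀⟩⟩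
    obtain ⟨i, htI, hle⟩ := mem_iUnion.1 ht₁
    simp only [mem_preimage, mem_Iic] at hle
    have hpos : 0 < t₁ := by
      refine lt_of_le_of_ne htI.1 fun h => ?_
      have := hp t₁ h.ge i
      have := mul_pos hε (Real.exp_pos ((K + 1) * t₁))
      linarith
    have hbefore : ∀ s, 0 ≤ s → s < t₁ → ∀ j, 0 < p s j + ε * Real.exp ((K + 1) * s) := by
      intro s hs hst j
      by_contra! h
      exact absurd (hmin (mem_iUnion.2 ⟨j, ⟨hs, hst.le.trans htI.2⟩, h⟩)) (not_le.2 hst)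
    have hev : ∀ᶠ s in 𝓝[<] t₁, s ∈ Ioo 0 t₁ := Ioo_mem_nhdsLT hpos
    have hat : ∀ j, HasDerivAt (fun r => p r j + ε * Real.exp ((K + 1) * r))
        (f t₁ j + ε * (Real.exp ((K + 1) * t₁) * ((K + 1) * 1))) t₁ := fun j =>
      ((hd t₁ htI j).hasDerivAt (Ici_mem_nhds hpos)).add
        ((((hasDerivAt_id t₁).const_mul (K + 1)).exp).const_mul ε)
    have hnow : ∀ j, 0 ≤ p t₁ j + ε * Real.exp ((K + 1) * t₁) := fun j =>
      ge_of_tendsto ((hat j).continuousAt.tendsto.mono_left nhdsWithin_le_nhds)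
        (hev.mono fun s hs => (hbefore s hs.1.le hs.2 j).le)
    set P := ε * Real.exp ((K + 1) * t₁) with hPdef
    have hP : 0 < P := mul_pos hε (Real.exp_pos _)
    have hpast : ∀ s ≤ t₁, ∀ j, -P ≤ p s j := by
      intro s hs j
      rcases le_or_gt s 0 with h0 | h0
      · linarith [hp s h0 j]
      · rcases hs.lt_or_eq with h | rfl
        · have h1 := hbefore s h0.le h j
          have h2 : ε * Real.exp ((K + 1) * s) ≤ P :=
            mul_le_mul_of_nonneg_left (Real.exp_le_exp.2 (by gcongr)) hε.le
          linarith
        · linarith [hnow j]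
    -- Here `p t₁ i ≤ -P < 0`, so the positive part vanishes and `f ≥ -K P`. The barrier term
    -- contributes `(K + 1) P`, so the sum has a positive derivative, although its left difference
    -- quotients are nonpositive near `t₁`.
    have hder := hf t₁ htI P hP.le hpast i
    rw [max_eq_right (by linarith), add_zero] at hder
    have hslope := (hasDerivAt_iff_tendsto_slope.1 (hat i)).mono_left
      (nhdsWithin_mono t₁ (fun s (hs : s ∈ Iio t₁) => hs.ne : Iio t₁ ⊆ {t₁}ᶜ))
    have hval : 0 < f t₁ i + ε * (Real.exp ((K + 1) * t₁) * ((K + 1) * 1)) := by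
      have : ε * (Real.exp ((K + 1) * t₁) * ((K + 1) * 1)) = (K + 1) * P := by
        rw [hPdef]; ring
      rw [this]; linarith
    obtain ⟨s, hs1, hs2⟩ := ((hslope.eventually_const_lt hval).and hev).exists
    rw [slope_def_field] at hs1
    have h1 := hbefore s hs2.1.le hs2.2 i
    have : (p s i + ε * Real.exp ((K + 1) * s) - (p t₁ i + P)) / (s - t₁) ≤ 0 :=
      div_nonpos_of_nonneg_of_nonpos (by linarith) (by linarith [hs2.2])
    linarith
  intro t htT i
  rcases le_or_gt t 0 with h0 | h0
  · exact hp t h0 i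
  by_contra! hneg
  -- This `ε` makes the barrier pass exactly through `p t i`, so that `key` reads `0 < 0`.
  have h := key (-p t i * Real.exp (-((K + 1) * t))) (mul_pos (by linarith) (Real.exp_pos _))
    t ⟨h0.le, htT⟩ i
  rw [mul_assoc, ← Real.exp_add] at h
  simp at h

/-- The product `exp(K t) p(t)` is nondecreasing. -/
theorem pos_of_hasDerivWithinAt_of_lower_bound {p f : ℝ → ℝ} {T K : ℝ}
    (hd : ∀ t ∈ Icc 0 T, HasDerivWithinAt p (f t) (Ici 0) t)
    (hf : ∀ t ∈ Icc 0 T, -(K * p t) ≤ f t) (h0 : 0 < p 0) :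
    ∀ t ∈ Icc 0 T, 0 < p t := by
  intro t ht
  have hmono : MonotoneOn (fun r => Real.exp (K * r) * p r) (Icc 0 T) := by
    refine monotoneOn_of_hasDerivWithinAt_nonneg (convex_Icc 0 T) ?_
      (f' := fun r => (Real.exp (K * r) * (K * 1)) * p r + Real.exp (K * r) * f r)
      (fun r hr => ?_) (fun r hr => ?_)
    · exact ContinuousOn.mul (by fun_prop) fun r hr =>
        (hd r hr).continuousWithinAt.mono Icc_subset_Ici_self
    · have hr' := interior_subset hr
      exact (((hasDerivAt_id r).const_mul K).exp).hasDerivWithinAt.mul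
        ((hd r hr').mono (interior_subset.trans Icc_subset_Ici_self))
    · have := hf r (interior_subset hr)
      have h2 : Real.exp (K * r) * (K * 1) * p r + Real.exp (K * r) * f r
        = Real.exp (K * r) * (K * p r + f r) := by ring
      rw [h2]
      exact mul_nonneg (Real.exp_pos _).le (by linarith)
  have h := hmono ⟨le_rfl, ht.1.trans ht.2⟩ ht ht.1
  simp only [mul_zero, Real.exp_zero, one_mul] at h
  exact pos_of_mul_pos_right (h0.trans_le h) (Real.exp_pos _).le

/-! ### Histories and segments -/

theorem shift_segment {m : ℕ} (z : ℝ → Fin m → ℝ) (t : ℝ) (s : Iic (0 : ℝ)) :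
    shift (segment z t) s = segment z (t + s) := by
  funext θ
  simp [shift, segment, add_assoc]

theorem continuous_segment {m : ℕ} {z : ℝ → Fin m → ℝ} {T t : ℝ}
    (hz : ContinuousOn z (Iic T)) (ht : t ≤ T) : Continuous (segment z t) :=
  hz.comp_continuous (by fun_prop) fun θ => by
    have := θ.2
    simp only [mem_Iic] at *
    linarith

theorem exists_norm_le_of_segment_mem_BU {m : ℕ} {z : ℝ → Fin m → ℝ} {T : ℝ}
    (hz : ContinuousOn z (Iic T)) (h0 : segment z 0 ∈ BU m) :
    ∃ R, ∀ s ≤ T, ‖z s‖ ≤ R := by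
  obtain ⟨C, hC⟩ := h0.1
  obtain ⟨C', hC'⟩ := isCompact_Icc.exists_bound_of_continuousOn
    (hz.mono (Icc_subset_Iic_self : Icc 0 T ⊆ Iic T))
  refine ⟨max C C', fun s hs => ?_⟩
  rcases le_or_gt s 0 with h | h
  · have := hC ⟨s, h⟩
    simp only [segment, zero_add] at this
    exact this.trans (le_max_left _ _)
  · exact (hC' s ⟨h.le, hs⟩).trans (le_max_right _ _)

theorem segment_mem_BU {m : ℕ} {z : ℝ → Fin m → ℝ} {T : ℝ} (hT : 0 ≤ T)
    (hz : ContinuousOn z (Iic T)) (h0 : segment z 0 ∈ BU m) : segment z T ∈ BU m := by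
  refine ⟨?_, ?_⟩
  · obtain ⟨R, hR⟩ := exists_norm_le_of_segment_mem_BU hz h0
    exact ⟨R, fun s => hR _ (by have := s.2; simp only [mem_Iic] at this; linarith)⟩
  · have huc : UniformContinuousOn z (Icc 0 T) :=
      isCompact_Icc.uniformContinuousOn_of_continuous (hz.mono Icc_subset_Iic_self)
    have hpast := h0.2
    rw [Metric.uniformContinuous_iff] at hpast ⊢
    rw [Metric.uniformContinuousOn_iff] at huc
    intro ε hε
    obtain ⟨δ₁, hδ₁, h₁⟩ := hpast (ε / 2) (half_pos hε)
    obtain ⟨δ₂, hδ₂, h₂⟩ := huc (ε / 2) (half_pos hε)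
    have h₁' : ∀ a b : ℝ, a ≤ 0 → b ≤ 0 → dist a b < δ₁ → dist (z a) (z b) < ε / 2 := by
      intro a b ha hb hab
      have := @h₁ ⟨a, ha⟩ ⟨b, hb⟩ hab
      simpa [segment] using this
    -- The moduli of continuity on the past and on `[0, T]` are glued by passing through time `0`
    -- when it separates the two points.
    have main : ∀ a b : ℝ, a ≤ b → b ≤ T → dist a b < min δ₁ δ₂ → dist (z a) (z b) < ε := by
      intro a b hab hb hd
      have hd₁ := hd.trans_le (min_le_left _ _)
      have hd₂ := hd.trans_le (min_le_right _ _)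
      rcases le_or_gt b 0 with hb0 | hb0
      · exact (h₁' a b (hab.trans hb0) hb0 hd₁).trans (half_lt_self hε)
      rcases le_or_gt 0 a with ha0 | ha0
      · exact (h₂ a ⟨ha0, hab.trans hb⟩ b ⟨hb0.le, hb⟩ hd₂).trans (half_lt_self hε)
      · rw [Real.dist_eq, abs_of_nonpos (by linarith)] at hd₁ hd₂
        have e₁ := h₁' a 0 ha0.le le_rfl (by
          rw [Real.dist_eq, abs_of_nonpos (by linarith)]; linarith)
        have e₂ := h₂ 0 ⟨le_rfl, hT⟩ b ⟨hb0.le, hb⟩ (by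
          rw [Real.dist_eq, abs_of_nonpos (by linarith)]; linarith)
        linarith [dist_triangle (z a) (z 0) (z b)]
    refine ⟨min δ₁ δ₂, lt_min hδ₁ hδ₂, fun {a b} hab => ?_⟩
    have ha := a.2
    have hb := b.2
    simp only [mem_Iic] at ha hb
    have hab' : dist (T + a.1) (T + b.1) < min δ₁ δ₂ := by
      rw [dist_add_left]; exact hab
    rcases le_total a.1 b.1 with h | h
    · exact main _ _ (by linarith) (by linarith) hab'
    · rw [dist_comm] at hab' ⊢
      exact main _ _ (by linarith) (by linarith) hab'

/-! ### The hull -/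

theorem translate_mem_hull {E : Type*} [TopologicalSpace E] {g w : C(ℝ × ℝ, E)}
    (hw : w ∈ hull g) (t : ℝ) : translate t w ∈ hull g := by
  have hc : Continuous (translate t : C(ℝ × ℝ, E) → C(ℝ × ℝ, E)) :=
    ContinuousMap.continuous_precomp (⟨fun p => (t + p.1, p.2), by fun_prop⟩ : C(ℝ × ℝ, ℝ × ℝ))
  have hm : MapsTo (translate t) (range fun r : ℝ => translate r g)
      (range fun r : ℝ => translate r g) := by
    rintro _ ⟨r, rfl⟩
    exact ⟨r + t, by ext p; simp [translate, add_assoc]⟩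
  exact hm.closure hc hw

/-- The means of passing from `g` to `Ω`: inequalities between point values are closed conditions,
so it suffices to check them on translates. -/
theorem hull_subset_of_isClosed {E : Type*} [TopologicalSpace E] {g : C(ℝ × ℝ, E)}
    {P : Set C(ℝ × ℝ, E)} (hP : IsClosed P) (h : ∀ t, translate t g ∈ P) : hull g ⊆ P :=
  closure_minimal (range_subset_iff.2 h) hP

theorem continuous_eval_component {ι : Type*} (p : ℝ × ℝ) (c : ι) :
    Continuous fun w : C(ℝ × ℝ, ι → ℝ) => w p c :=
  (continuous_apply c).comp (continuous_eval_const p)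

/-- Each line `ℝ × {v}` has a neighbourhood `ℝ × ball` on which `f` is bounded; compactness of `[-R,
R]` leaves finitely many. -/
theorem exists_bound_of_bddUnifContAlong {f : ℝ → ℝ → ℝ} (hf : ∀ v, BddUnifContAlong f v)
    (R : ℝ) : ∃ C, ∀ t v, |v| ≤ R → |f t v| ≤ C := by
  have : ∃ C, ∀ t, ∀ v ∈ Icc (-R) R, |f t v| ≤ C := by
    refine isCompact_Icc.induction_on (p := fun s => ∃ C, ∀ t, ∀ v ∈ s, |f t v| ≤ C)
      ⟨0, by simp⟩ ?_ ?_ ?_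
    · rintro s s' hs ⟨C, hC⟩
      exact ⟨C, fun t v hv => hC t v (hs hv)⟩
    · rintro s s' ⟨C, hC⟩ ⟨C', hC'⟩
      refine ⟨max C C', fun t v hv => ?_⟩
      rcases hv with hv | hv
      · exact (hC t v hv).trans (le_max_left _ _)
      · exact (hC' t v hv).trans (le_max_right _ _)
    · intro v _
      obtain ⟨⟨C, hC⟩, h⟩ := hf v
      obtain ⟨δ, hδ, h⟩ := h 1 one_pos
      refine ⟨Metric.ball v δ, mem_nhdsWithin_of_mem_nhds (Metric.ball_mem_nhds v hδ),
        C + 1, fun t u hu => ?_⟩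
      have h1 := h t t u (by simpa using hδ) (by simpa [Real.dist_eq] using hu)
      have h2 := hC t
      have h3 := abs_sub_abs_le_abs_sub (f t u) (f t v)
      linarith
  obtain ⟨C, hC⟩ := this
  exact ⟨C, fun t v hv => hC t v (abs_le.1 hv)⟩

namespace Compartmental

variable {m : ℕ} {S : Compartmental m}

/-! ### The measures and the operator `D` -/

theorem C3.isProbabilityMeasure (h : S.C3) (i j : Fin m) : IsProbabilityMeasure (S.μ i j) :=
  ⟨(h i j).1⟩

theorem C4.isFiniteMeasure (h : S.C4) (i j : Fin m) : IsFiniteMeasure (S.ν i j) :=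
  ⟨((Finset.single_le_sum (f := fun j => S.ν i j univ) (fun _ _ => zero_le)
    (Finset.mem_univ j)).trans_lt (h.2 i)).trans ENNReal.one_lt_top⟩

theorem C4.exists_mass_le (h : S.C4) :
    ∃ ρ : ℝ, 0 ≤ ρ ∧ ρ < 1 ∧ ∀ i, ∑ j, (S.ν i j).real univ ≤ ρ := by
  have hlt : (Finset.univ.sup fun i => ∑ j, S.ν i j univ) < 1 :=
    (Finset.sup_lt_iff (by simp)).2 fun i _ => h.2 i
  refine ⟨(Finset.univ.sup fun i => ∑ j, S.ν i j univ).toReal, ENNReal.toReal_nonneg, ?_,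
    fun i => ?_⟩
  · exact (ENNReal.toReal_lt_toReal hlt.ne_top ENNReal.one_ne_top).2 hlt
  · have := h.isFiniteMeasure i
    simp only [measureReal_def]
    rw [← ENNReal.toReal_sum fun j _ => measure_ne_top _ _]
    exact ENNReal.toReal_mono hlt.ne_top
      (Finset.le_sup (f := fun i => ∑ j, S.ν i j univ) (Finset.mem_univ i))

theorem integrable_of_continuous_of_bound {X : Type*} [TopologicalSpace X] [MeasurableSpace X]
    [BorelSpace X] {μ : Measure X} [IsFiniteMeasure μ] {f : X → ℝ} (hf : Continuous f) {C : ℝ}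
    (hC : ∀ s, |f s| ≤ C) : Integrable f μ :=
  Integrable.of_bound hf.measurable.aestronglyMeasurable C
    (ae_of_all _ hC)

theorem abs_apply_le_of_norm_le {x : Hist m} {R : ℝ} (hx : ∀ s, ‖x s‖ ≤ R) (s : Iic (0 : ℝ))
    (j : Fin m) : |x s j| ≤ R :=
  (norm_le_pi_norm (x s) j).trans (hx s)

theorem integrable_apply (μ : Measure (Iic (0 : ℝ))) [IsFiniteMeasure μ] {x : Hist m} {R : ℝ}
    (hx : Continuous x) (hR : ∀ s, ‖x s‖ ≤ R) (j : Fin m) : Integrable (fun s => x s j) μ :=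
  integrable_of_continuous_of_bound ((continuous_apply j).comp hx) fun s =>
    abs_apply_le_of_norm_le hR s j

theorem D_sub (h : S.C4) {x y : Hist m} {R : ℝ} (hx : Continuous x) (hy : Continuous y)
    (hxR : ∀ s, ‖x s‖ ≤ R) (hyR : ∀ s, ‖y s‖ ≤ R) (i : Fin m) :
    S.D (fun s => y s - x s) i = S.D y i - S.D x i := by
  have := h.isFiniteMeasure i
  simp only [D, Pi.sub_apply, at0]
  have : ∀ j, ∫ s, (y s j - x s j) ∂(S.ν i j) = ∫ s, y s j ∂(S.ν i j) - ∫ s, x s j ∂(S.ν i j) :=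
    fun j => integral_sub (integrable_apply _ hy hyR j) (integrable_apply _ hx hxR j)
  simp only [this, Finset.sum_sub_distrib]
  ring

theorem continuous_shift {x : Hist m} (hx : Continuous x) (s : Iic (0 : ℝ)) :
    Continuous (shift x s) :=
  hx.comp (by fun_prop)

/-- Bounded histories are controlled from below by their image under `D`. -/
theorem C4.exists_lower_bound (h : S.C4) :
    ∃ C : ℝ, 0 ≤ C ∧ ∀ (w : Hist m) (R P : ℝ), Continuous w → (∀ s, ‖w s‖ ≤ R) →
      (∀ s i, -P ≤ S.D (shift w s) i) → 0 ≤ P → ∀ s i, -(C * P) ≤ w s i := by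
  obtain ⟨ρ, h0, h1, hρ⟩ := h.exists_mass_le
  have h1' : 0 < 1 - ρ := by linarith
  refine ⟨(1 - ρ)⁻¹, by positivity, fun w R P hw hR hP hP0 s i => ?_⟩
  set C := (1 - ρ)⁻¹
  -- `C P` is the fixed point of `Q ↦ P + ρ Q`, the map that improves a lower bound `-Q` below.
  have hCP : P + ρ * (C * P) = C * P := by
    have : (1 - ρ) * C = 1 := mul_inv_cancel₀ h1'.ne'
    linear_combination (-P) * this
  have hCP0 : 0 ≤ C * P := mul_nonneg (inv_nonneg.2 h1'.le) hP0
  have hR0 : 0 ≤ R := (norm_nonneg _).trans (hR s)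
  -- Solving `D` for the value at time `s` expresses `w s i` as a term `≥ -P` plus integrals of mass
  -- at most `ρ`. Each use contracts the distance from the crude bound `R` to the fixed point by
  -- `ρ`.
  have iter : ∀ n : ℕ, ∀ s i, -(C * P + ρ ^ n * R) ≤ w s i := by
    intro n
    induction n with
    | zero =>
      intro s i
      have := (abs_le.1 (abs_apply_le_of_norm_le hR s i)).1
      simp only [pow_zero, one_mul]
      linarith
    | succ n ih =>
      intro s i
      have hfin := h.isFiniteMeasure i
      have hD := hP s i
      simp only [D] at hD
      have hval : at0 (shift w s) i = w s i := by simp [at0, shift]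
      set Q := C * P + ρ ^ n * R
      have hQ : 0 ≤ Q := by positivity
      have hint : ∀ j, -(Q * (S.ν i j).real univ) ≤ ∫ θ, shift w s θ j ∂(S.ν i j) := by
        intro j
        have := integral_mono (μ := S.ν i j) (f := fun _ => -Q) (integrable_const _)
          (integrable_apply _ (continuous_shift hw s) (fun θ => hR _) j) (fun θ => ih _ j)
        simp only [integral_const, smul_eq_mul] at this
        linarith
      have hsum : -(Q * ρ) ≤ ∑ j, ∫ θ, shift w s θ j ∂(S.ν i j) := by
        refine le_trans ?_ (Finset.sum_le_sum fun j _ => hint j)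
        rw [Finset.sum_neg_distrib, ← Finset.mul_sum]
        exact neg_le_neg (mul_le_mul_of_nonneg_left (hρ i) hQ)
      rw [hval] at hD
      have : C * P + ρ ^ (n + 1) * R = P + Q * ρ := by
        simp only [Q]
        linear_combination (-1 : ℝ) * hCP
      linarith
  have hlim : Tendsto (fun n : ℕ => -(C * P + ρ ^ n * R)) atTop (𝓝 (-(C * P + 0 * R))) :=
    (((tendsto_pow_atTop_nhds_zero_of_lt_one h0 h1).mul_const R).const_add _).neg
  have := le_of_tendsto' hlim fun n => iter n s i
  simpa using this

/-! ### Bounds for the transport functions on the hull -/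

theorem C1.exists_bound_comp (h : S.C1) (R : ℝ) :
    ∃ B, ∀ w ∈ S.Ω, ∀ c t v, |v| ≤ R → |w (t, v) c| ≤ B := by
  choose B hB using fun c => exists_bound_of_bddUnifContAlong (fun v => (h.2.1 c v).1) R
  obtain ⟨M, hM⟩ := Finite.exists_le B
  refine ⟨M, fun w hw c t v hv => ?_⟩
  have hcl : IsClosed {w : C(ℝ × ℝ, Flux m → ℝ) | |w (t, v) c| ≤ M} :=
    isClosed_le (continuous_eval_component (t, v) c).abs continuous_const
  exact hull_subset_of_isClosed hcl (fun r => (hB c (r + t) v hv).trans (hM c)) hw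

theorem C1.exists_bound_dcomp (h : S.C1) (R : ℝ) :
    ∃ L, 0 ≤ L ∧ ∀ c t v, |v| ≤ R → S.dcomp c t v ≤ L := by
  choose B hB using fun c => exists_bound_of_bddUnifContAlong (fun v => (h.2.1 c v).2) R
  obtain ⟨M, hM⟩ := Finite.exists_le B
  exact ⟨max M 0, le_max_right _ _, fun c t v hv =>
    (le_abs_self _).trans ((hB c t v hv).trans ((hM c).trans (le_max_left _ _)))⟩

theorem C1.dcomp_nonneg (h : S.C1) (c : Flux m) (t v : ℝ) : 0 ≤ S.dcomp c t v :=
  (h.2.2.1 c t).deriv_nonneg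

theorem cInf_ne_top (k : Option (Fin m)) (j : Fin m) : S.cInf k j ≠ ⊤ :=
  ((iInf_le _ (0, 0)).trans_lt ENNReal.ofReal_lt_top).ne

theorem C1.cInf_toReal_le (h : S.C1) (k : Option (Fin m)) (j : Fin m) (t v : ℝ) :
    (S.cInf k j).toReal ≤ S.dcomp (Sum.inl (k, j)) t v :=
  ENNReal.toReal_le_of_le_ofReal (h.dcomp_nonneg _ t v) (iInf_le _ (t, v))

/-- The mean value inequality is stated for increments because that form survives limits; elements
of the hull never have to be differentiated. -/
theorem C1.le_sub_of_le (h : S.C1) {w : C(ℝ × ℝ, Flux m → ℝ)} (hw : w ∈ S.Ω)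
    (k : Option (Fin m)) (j : Fin m) (t : ℝ) {u v : ℝ} (huv : u ≤ v) :
    (S.cInf k j).toReal * (v - u) ≤ w (t, v) (Sum.inl (k, j)) - w (t, u) (Sum.inl (k, j)) := by
  have hcl : IsClosed {w : C(ℝ × ℝ, Flux m → ℝ) | (S.cInf k j).toReal * (v - u)
      ≤ w (t, v) (Sum.inl (k, j)) - w (t, u) (Sum.inl (k, j))} :=
    isClosed_le continuous_const
      ((continuous_eval_component (t, v) _).sub (continuous_eval_component (t, u) _))
  refine hull_subset_of_isClosed hcl (fun r => ?_) hw
  exact mul_sub_le_image_sub_of_le_deriv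
    (f := fun v => S.comp (Sum.inl (k, j)) (r + t) v)
    ((h.1 _ _).differentiable one_ne_zero) (fun v => h.cInf_toReal_le k j (r + t) v) huv

/-- The minimum keeps the slope finite when `d_{kj} = ∞`, while it stays below `d_{kj}` as needed
for (C5). -/
theorem C1.sub_le_of_le (h : S.C1) {L R : ℝ}
    (hL : ∀ c t v, |v| ≤ R → S.dcomp c t v ≤ L) {w : C(ℝ × ℝ, Flux m → ℝ)} (hw : w ∈ S.Ω)
    (k : Option (Fin m)) (j : Fin m) (t : ℝ) {u v : ℝ} (huv : u ≤ v) (hu : |u| ≤ R)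
    (hv : |v| ≤ R) :
    w (t, v) (Sum.inl (k, j)) - w (t, u) (Sum.inl (k, j))
      ≤ (min (S.dSup k j) (ENNReal.ofReal L)).toReal * (v - u) := by
  have hcl : IsClosed {w : C(ℝ × ℝ, Flux m → ℝ) |
      w (t, v) (Sum.inl (k, j)) - w (t, u) (Sum.inl (k, j))
        ≤ (min (S.dSup k j) (ENNReal.ofReal L)).toReal * (v - u)} :=
    isClosed_le
      ((continuous_eval_component (t, v) _).sub (continuous_eval_component (t, u) _))
      continuous_const
  refine hull_subset_of_isClosed hcl (fun r => ?_) hw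
  have hd := (h.1 (Sum.inl (k, j)) (r + t)).differentiable one_ne_zero
  refine (convex_Icc (-R) R).image_sub_le_mul_sub_of_deriv_le
    (f := fun v => S.comp (Sum.inl (k, j)) (r + t) v)
    hd.continuous.continuousOn hd.differentiableOn (fun a ha => ?_)
    u (abs_le.1 hu) v (abs_le.1 hv) huv
  have hfin : min (S.dSup k j) (ENNReal.ofReal L) ≠ ⊤ :=
    ((min_le_right _ _).trans_lt ENNReal.ofReal_lt_top).ne
  refine (ENNReal.ofReal_le_iff_le_toReal hfin).1 (le_min ?_ ?_)
  · exact le_iSup (fun p : ℝ × ℝ => ENNReal.ofReal (S.dcomp (Sum.inl (k, j)) p.1 p.2)) (r + t, a)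
  · exact ENNReal.ofReal_le_ofReal (hL _ _ _ (abs_le.2 (mem_Icc.1 (interior_subset ha))))

/-- Condition (C5) integrated against a nonnegative function. A finite `e` below the possibly
infinite sum replaces it, so real-valued integrals suffice. -/
theorem C5.mul_integral_le (h5 : S.C5) (h3 : S.C3) {i j : Fin m} {e : ℝ} (he0 : 0 ≤ e)
    (he : ENNReal.ofReal e ≤ ∑ k, S.dSup k i) {f : Iic (0 : ℝ) → ℝ} (hf : Continuous f)
    (hf0 : ∀ s, 0 ≤ f s) {C : ℝ} (hC : ∀ s, |f s| ≤ C) :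
    e * ∫ s, f s ∂(S.ν i j) ≤ (S.cInf (some i) j).toReal * ∫ s, f s ∂(S.μ i j) := by
  have := h3.isProbabilityMeasure i j
  have hle : ENNReal.ofReal e • S.ν i j ≤ S.cInf (some i) j • S.μ i j := by
    refine le_trans (fun s => ?_) (h5 i j)
    simp only [Measure.smul_apply, smul_eq_mul]
    gcongr
  have := integral_mono_measure hle (ae_of_all _ hf0)
    ((integrable_of_continuous_of_bound hf hC).smul_measure (cInf_ne_top _ _))
  simpa only [integral_smul_measure, smul_eq_mul, ENNReal.toReal_ofReal he0] using this

/-- The one-sided estimate for `F` behind quasimonotonicity and the comparison of solutions. -/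
theorem exists_F_lower_bound (h1 : S.C1) (h3 : S.C3) (h4 : S.C4) (h5 : S.C5) (R : ℝ) :
    ∃ K : ℝ, 0 ≤ K ∧ ∀ w ∈ S.Ω, ∀ x y : Hist m, Continuous x → Continuous y →
      (∀ s, ‖x s‖ ≤ R) → (∀ s, ‖y s‖ ≤ R) → ∀ V, 0 ≤ V → (∀ s j, -V ≤ y s j - x s j) →
        ∀ i, -(K * (V + max (S.D y i - S.D x i) 0)) ≤ S.F w y i - S.F w x i := by
  obtain ⟨L, hL0, hL⟩ := h1.exists_bound_dcomp R
  obtain ⟨B, hB⟩ := h1.exists_bound_comp R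
  refine ⟨(m + 1) * L, by positivity, fun w hw x y hx hy hxR hyR V hV hxy i => ?_⟩
  have hμ := h3.isProbabilityMeasure i
  have hν := h4.isFiniteMeasure i
  have axR := abs_apply_le_of_norm_le hxR
  have ayR := abs_apply_le_of_norm_le hyR
  set e : Option (Fin m) → ℝ := fun k => (min (S.dSup k i) (ENNReal.ofReal L)).toReal with hedef
  have he_nonneg : ∀ k, 0 ≤ e k := fun k => ENNReal.toReal_nonneg
  have hmin_le : ∀ k j, (min (S.dSup k j) (ENNReal.ofReal L)).toReal ≤ L := fun k j =>
    ENNReal.toReal_le_of_le_ofReal hL0 (min_le_right _ _)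
  set E := ∑ k, e k with hE
  have hE0 : 0 ≤ E := Finset.sum_nonneg fun k _ => he_nonneg k
  have hEL : E ≤ (m + 1) * L := by
    refine (Finset.sum_le_sum fun k _ => hmin_le k i).trans_eq ?_
    simp
  have hEd : ENNReal.ofReal E ≤ ∑ k, S.dSup k i := by
    rw [hE, ENNReal.ofReal_sum_of_nonneg fun k _ => he_nonneg k]
    exact Finset.sum_le_sum fun k _ => ENNReal.ofReal_toReal_le.trans (min_le_left _ _)
  set p := max (S.D y i - S.D x i) 0 with hp
  have hp0 : 0 ≤ p := le_max_right _ _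
  -- Only the positive part of `y - x` is balanced between `ν` and `μ`; the negative part is at most
  -- `V` and enters the error term.
  set W : Fin m → Iic (0 : ℝ) → ℝ := fun j s => max (y s j - x s j) 0 with hW
  have hWc : ∀ j, Continuous (W j) := fun j =>
    (((continuous_apply j).comp hy).sub ((continuous_apply j).comp hx)).max continuous_const
  have hW0 : ∀ j s, 0 ≤ W j s := fun j s => le_max_right _ _
  have hWb : ∀ j s, |W j s| ≤ R + R := fun j s => by
    have h1 := abs_le.1 (axR s j)
    have h2 := abs_le.1 (ayR s j)
    rw [abs_of_nonneg (hW0 j s)]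
    exact max_le (by linarith) (by linarith)
  set A := p + ∑ j, ∫ s, W j s ∂(S.ν i j) with hA
  have hA0 : 0 ≤ A := add_nonneg hp0
    (Finset.sum_nonneg fun j _ => integral_nonneg (hW0 j))
  -- The value at `0` is recovered from `D`: `y_i(0) - x_i(0) = (D_i y - D_i x) + ∑ⱼ ∫ (y_j - x_j)
  -- dν_{ij}`.
  have hWA : max (at0 y i - at0 x i) 0 ≤ A := by
    refine max_le ?_ hA0
    have hD := D_sub h4 hx hy hxR hyR i
    have hsum : ∑ j, ∫ s, (y s j - x s j) ∂(S.ν i j) ≤ ∑ j, ∫ s, W j s ∂(S.ν i j) :=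
      Finset.sum_le_sum fun j _ => integral_mono
        ((integrable_apply _ hy hyR j).sub (integrable_apply _ hx hxR j))
        (integrable_of_continuous_of_bound (hWc j) (hWb j)) fun s => le_max_left _ _
    have hDe : S.D (fun s => y s - x s) i
      = at0 y i - at0 x i - ∑ j, ∫ s, (y s j - x s j) ∂(S.ν i j) := rfl
    have := le_max_left (S.D y i - S.D x i) 0
    linarith
  -- The extra outflow is charged to `p` and, through (C5), to the `μ`-integrals of `W`.
  have hout : ∑ k, (gHull k i w (at0 y i) - gHull k i w (at0 x i))
      ≤ E * p + ∑ j, (S.cInf (some i) j).toReal * ∫ s, W j s ∂(S.μ i j) := by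
    have hk : ∀ k, gHull k i w (at0 y i) - gHull k i w (at0 x i)
        ≤ e k * max (at0 y i - at0 x i) 0 := by
      intro k
      rcases le_total (at0 x i) (at0 y i) with h | h
      · refine (h1.sub_le_of_le hL hw k i 0 h (axR _ i) (ayR _ i)).trans ?_
        exact mul_le_mul_of_nonneg_left (le_max_left _ _) (he_nonneg k)
      · have hle := h1.le_sub_of_le hw k i 0 h
        have h0 : 0 ≤ (S.cInf k i).toReal * (at0 x i - at0 y i) :=
          mul_nonneg ENNReal.toReal_nonneg (by linarith)
        have h0' : 0 ≤ e k * max (at0 y i - at0 x i) 0 :=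
          mul_nonneg (he_nonneg k) (le_max_right _ _)
        simp only [gHull]
        linarith
    calc ∑ k, (gHull k i w (at0 y i) - gHull k i w (at0 x i))
        ≤ ∑ k, e k * max (at0 y i - at0 x i) 0 := Finset.sum_le_sum fun k _ => hk k
      _ = E * max (at0 y i - at0 x i) 0 := by rw [hE, Finset.sum_mul]
      _ ≤ E * A := mul_le_mul_of_nonneg_left hWA hE0
      _ = E * p + ∑ j, E * ∫ s, W j s ∂(S.ν i j) := by rw [hA, mul_add, Finset.mul_sum]
      _ ≤ _ := by
        refine add_le_add le_rfl (Finset.sum_le_sum fun j _ => ?_)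
        exact h5.mul_integral_le h3 hE0 hEd (hWc j) (hW0 j) (hWb j)
  have hintegrable : ∀ j, ∀ z : Hist m, Continuous z → (∀ s j, |z s j| ≤ R) →
      Integrable (fun s : Iic (0 : ℝ) => gHull (some i) j (translate (s : ℝ) w) (z s j))
        (S.μ i j) := by
    intro j z hz hzR
    refine integrable_of_continuous_of_bound (C := B) ?_ fun s => hB _
      (translate_mem_hull hw _) _ _ _ (hzR s j)
    have hzj : Continuous fun s => z s j := (continuous_apply j).comp hz
    have hpair : Continuous fun s : Iic (0 : ℝ) => ((s : ℝ) + 0, z s j) :=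
      (continuous_subtype_val.add continuous_const).prodMk hzj
    exact (continuous_apply (Sum.inl (some i, j))).comp (w.continuous.comp hpair)
  -- Where `y_j ≥ x_j` the transport gains at least `c_{ij} W_j`; elsewhere `W_j = 0` and the loss
  -- is at most `L V`. The term `c_{ij} ∫ W_j dμ_{ij}` is the one that bounds the outflow in `hout`,
  -- so the two cancel.
  have hin : ∑ j, ((S.cInf (some i) j).toReal * ∫ s, W j s ∂(S.μ i j) - L * V)
      ≤ ∑ j, (∫ s : Iic (0 : ℝ), gHull (some i) j (translate (s : ℝ) w) (y s j) ∂(S.μ i j)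
        - ∫ s : Iic (0 : ℝ), gHull (some i) j (translate (s : ℝ) w) (x s j) ∂(S.μ i j)) := by
    refine Finset.sum_le_sum fun j _ => ?_
    rw [← integral_sub (hintegrable j y hy ayR) (hintegrable j x hx axR)]
    have hWi : Integrable (W j) (S.μ i j) := integrable_of_continuous_of_bound (hWc j) (hWb j)
    have heq : (S.cInf (some i) j).toReal * ∫ s, W j s ∂(S.μ i j) - L * V
        = ∫ s, ((S.cInf (some i) j).toReal * W j s - L * V) ∂(S.μ i j) := by
      rw [integral_sub (hWi.const_mul _) (integrable_const _), integral_const_mul]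
      simp
    rw [heq]
    refine integral_mono ((hWi.const_mul _).sub (integrable_const _))
      ((hintegrable j y hy ayR).sub (hintegrable j x hx axR)) fun s => ?_
    have hws := translate_mem_hull hw s.1
    have hLV : 0 ≤ L * V := mul_nonneg hL0 hV
    rcases le_total (x s j) (y s j) with h | h
    · have hle := h1.le_sub_of_le hws (some i) j 0 h
      simp only [hW, gHull]
      rw [max_eq_left (by linarith)]
      linarith
    · have hle := h1.sub_le_of_le hL hws (some i) j 0 h (ayR s j) (axR s j)
      have h2 : (min (S.dSup (some i) j) (ENNReal.ofReal L)).toReal * (x s j - y s j)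
          ≤ L * V :=
        mul_le_mul (hmin_le _ _) (by linarith [hxy s j]) (by linarith) hL0
      simp only [hW, gHull]
      rw [max_eq_right (by linarith)]
      linarith
  rw [Fintype.sum_option] at hout
  simp only [Finset.sum_sub_distrib, Finset.sum_const, Finset.card_univ, Fintype.card_fin,
    nsmul_eq_mul] at hout hin
  have hEp : E * p ≤ (m + 1) * L * p := mul_le_mul_of_nonneg_right hEL hp0
  have hLV : 0 ≤ L * V := mul_nonneg hL0 hV
  simp only [F]
  linarith

/-! ### Comparison -/

/-- Comparison of functions `x`, `y` whose images under `D` satisfy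
`(D y_t - D x_t)' ≥ F(ω·t, y_t) - F(ω·t, x_t)`. -/
theorem comparison (h1 : S.C1) (h3 : S.C3) (h4 : S.C4) (h5 : S.C5)
    {w : C(ℝ × ℝ, Flux m → ℝ)} (hw : w ∈ S.Ω) {x y f : ℝ → Fin m → ℝ} {T : ℝ} (hT : 0 ≤ T)
    (hx : ContinuousOn x (Iic T)) (hy : ContinuousOn y (Iic T))
    (hx0 : segment x 0 ∈ BU m) (hy0 : segment y 0 ∈ BU m)
    (hle : LeD S.D (segment x 0) (segment y 0))
    (hd : ∀ t ∈ Icc 0 T, ∀ i, HasDerivWithinAt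
      (fun r => S.D (segment y r) i - S.D (segment x r) i) (f t i) (Ici 0) t)
    (hf : ∀ t ∈ Icc 0 T, ∀ i,
      S.F (translate t w) (segment y t) i - S.F (translate t w) (segment x t) i ≤ f t i) :
    (∀ t ≤ T, S.D (segment x t) ≤ S.D (segment y t)) ∧
      ∀ i, S.D (segment x 0) i < S.D (segment y 0) i →
        S.D (segment x T) i < S.D (segment y T) i := by
  obtain ⟨Rx, hRx⟩ := exists_norm_le_of_segment_mem_BU hx hx0
  obtain ⟨Ry, hRy⟩ := exists_norm_le_of_segment_mem_BU hy hy0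
  set R := max Rx Ry
  have hadd : ∀ {t : ℝ}, t ≤ T → ∀ s : Iic (0 : ℝ), t + s ≤ T := fun ht s => by
    have := s.2
    simp only [mem_Iic] at this
    linarith
  have hxR : ∀ {t}, t ≤ T → ∀ s, ‖segment x t s‖ ≤ R := fun ht s =>
    (hRx _ (hadd ht s)).trans (le_max_left _ _)
  have hyR : ∀ {t}, t ≤ T → ∀ s, ‖segment y t s‖ ≤ R := fun ht s =>
    (hRy _ (hadd ht s)).trans (le_max_right _ _)
  obtain ⟨K, hK0, hK⟩ := exists_F_lower_bound h1 h3 h4 h5 R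
  obtain ⟨C, hC0, hC⟩ := h4.exists_lower_bound
  have hDsub : ∀ {t}, t ≤ T → ∀ i, S.D (segment (fun r => y r - x r) t) i
      = S.D (segment y t) i - S.D (segment x t) i := fun ht i =>
    D_sub h4 (continuous_segment hx ht) (continuous_segment hy ht) (hxR ht) (hyR ht) i
  -- The lower bound `-P` for `D` over the past becomes the bound `-C P` for `y - x`, which is the
  -- `V` of the estimate for `F`.
  have hest : ∀ t ∈ Icc 0 T, ∀ P, 0 ≤ P →
      (∀ s ≤ t, ∀ j, -P ≤ S.D (segment y s) j - S.D (segment x s) j) →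
      ∀ i, -(K * (C * P + max (S.D (segment y t) i - S.D (segment x t) i) 0)) ≤ f t i := by
    intro t ht P hP hlow i
    refine le_trans ?_ (hf t ht i)
    refine hK _ (translate_mem_hull hw t) _ _ (continuous_segment hx ht.2)
      (continuous_segment hy ht.2) (hxR ht.2) (hyR ht.2) (C * P) (mul_nonneg hC0 hP) ?_ i
    refine hC (segment (fun r => y r - x r) t) (R + R) P (continuous_segment (hy.sub hx) ht.2)
      (fun s => (norm_sub_le _ _).trans (add_le_add (hyR ht.2 s) (hxR ht.2 s)))
      (fun s j => ?_) hP
    rw [shift_segment, hDsub (hadd ht.2 s)]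
    exact hlow _ (by have := s.2; simp only [mem_Iic] at this; linarith) j
  have hpast : ∀ s ≤ 0, ∀ i, 0 ≤ S.D (segment y s) i - S.D (segment x s) i := by
    intro s hs i
    have := hle ⟨s, hs⟩ i
    rw [shift_segment, shift_segment] at this
    simpa using this
  have hnonneg : ∀ t ≤ T, ∀ i, 0 ≤ S.D (segment y t) i - S.D (segment x t) i := by
    -- The constant comes from `C P + q ≤ (C + 1) (P + q)` for `P, q ≥ 0`.
    refine nonneg_of_hasDerivWithinAt_of_lower_bound (K := K * (C + 1))
      (p := fun t i => S.D (segment y t) i - S.D (segment x t) i)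
      (mul_nonneg hK0 (by linarith)) hpast hd fun t ht P hP hlow i => ?_
    refine le_trans (neg_le_neg ?_) (hest t ht P hP hlow i)
    rw [mul_assoc]
    refine mul_le_mul_of_nonneg_left ?_ hK0
    have := mul_nonneg hC0
      (le_max_right (S.D (segment y t) i - S.D (segment x t) i) 0)
    linarith
  refine ⟨fun t ht i => sub_nonneg.1 (hnonneg t ht i), fun i hi => sub_pos.1 ?_⟩
  refine pos_of_hasDerivWithinAt_of_lower_bound (K := K)
    (p := fun t => S.D (segment y t) i - S.D (segment x t) i) (fun t ht => hd t ht i)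
    (fun t ht => ?_) (sub_pos.2 hi) T ⟨hT, le_rfl⟩
  -- Nonnegativity over the whole past allows `P = 0`: the coupling to the other components drops
  -- out and a scalar linear inequality remains.
  have := hest t ht 0 le_rfl (fun s hs j => by
    rw [neg_zero]; exact hnonneg s (hs.trans ht.2) j) i
  rwa [mul_zero, zero_add, max_eq_left (hnonneg t ht.2 i)] at this

theorem quasimonotone (h1 : S.C1) (h3 : S.C3) (h4 : S.C4) (h5 : S.C5) :
    Quasimonotone S.Ω S.D S.F := by
  intro x hx y hy hle j hj w hw
  obtain ⟨⟨Rx, hRx⟩, hxu⟩ := hx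
  obtain ⟨⟨Ry, hRy⟩, hyu⟩ := hy
  have hxc := hxu.continuous
  have hyc := hyu.continuous
  have hxR : ∀ s, ‖x s‖ ≤ max Rx Ry := fun s => (hRx s).trans (le_max_left _ _)
  have hyR : ∀ s, ‖y s‖ ≤ max Rx Ry := fun s => (hRy s).trans (le_max_right _ _)
  obtain ⟨K, hK0, hK⟩ := exists_F_lower_bound h1 h3 h4 h5 (max Rx Ry)
  obtain ⟨C, hC0, hC⟩ := h4.exists_lower_bound
  have hxy : ∀ s i, -(C * 0) ≤ y s i - x s i := by
    refine hC (fun s => y s - x s) _ 0 (hyc.sub hxc)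
      (fun s => (norm_sub_le _ _).trans (add_le_add (hyR s) (hxR s))) (fun s i => ?_) le_rfl
    have := D_sub h4 (continuous_shift hxc s) (continuous_shift hyc s)
      (fun θ => hxR _) (fun θ => hyR _) i
    rw [neg_zero]
    exact (sub_nonneg.2 (hle s i)).trans_eq this.symm
  have := hK w hw x y hxc hyc hxR hyR 0 le_rfl (by simpa using hxy) j
  simpa [hj] using this

end Compartmental

/-! ### Solutions: separation and positive invariance -/

theorem IsSolution.continuousOn_Iic {m : ℕ} {W : Type*} {flow : ℝ → W → W}
    {D : Hist m → Fin m → ℝ} {F : W → Hist m → Fin m → ℝ} {w : W} {x : Hist m} {b : EReal}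
    {z : ℝ → Fin m → ℝ} (h : IsSolution flow D F w x b z) {T : ℝ} (hT : (T : EReal) < b) :
    ContinuousOn z (Iic T) :=
  h.continuousOn.mono fun _ ht => (EReal.coe_le_coe_iff.2 ht).trans_lt hT

theorem IsSolution.hasDerivWithinAt_apply {m : ℕ} {W : Type*} {flow : ℝ → W → W}
    {D : Hist m → Fin m → ℝ} {F : W → Hist m → Fin m → ℝ} {w : W} {x : Hist m} {b : EReal}
    {z : ℝ → Fin m → ℝ} (h : IsSolution flow D F w x b z) {T : ℝ} (hT : (T : EReal) < b)
    {t : ℝ} (ht : t ∈ Icc 0 T) (i : Fin m) :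
    HasDerivWithinAt (fun r => D (segment z r) i) (F (flow t w) (segment z t) i) (Ici 0) t :=
  hasDerivWithinAt_pi.1 (h.equation t ht.1 ((EReal.coe_le_coe_iff.2 ht.2).trans_lt hT)) i

namespace Compartmental

variable {m : ℕ} {S : Compartmental m}

theorem componentwiseSeparating (h1 : S.C1) (h3 : S.C3) (h4 : S.C4) (h5 : S.C5) :
    ComponentwiseSeparating S.Ω translate S.D S.F := by
  intro x hx y hy hle i hi w hw b zx zy hzx hzy T hT hTb
  have hix := hzx.initial
  have hiy := hzy.initial
  subst hix hiy
  exact (comparison h1 h3 h4 h5 hw hT (hzx.continuousOn_Iic hTb) (hzy.continuousOn_Iic hTb)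
    hx hy hle (f := fun t => S.F (translate t w) (segment zy t)
      - S.F (translate t w) (segment zx t))
    (fun t ht j => (hzy.hasDerivWithinAt_apply hTb ht j).sub
      (hzx.hasDerivWithinAt_apply hTb ht j)) (fun t _ j => le_rfl)).2 i hi

theorem D_segment_zero (t : ℝ) (i : Fin m) : S.D (segment (0 : ℝ → Fin m → ℝ) t) i = 0 := by
  simp [D, segment, at0]

/-- At the zero history all transport terms vanish and only the inflow remains. -/
theorem C1.F_zero_nonneg (h : S.C1) {w : C(ℝ × ℝ, Flux m → ℝ)} (hw : w ∈ S.Ω) (t : ℝ)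
    (i : Fin m) : 0 ≤ S.F w (segment (0 : ℝ → Fin m → ℝ) t) i := by
  have hz : ∀ w ∈ S.Ω, ∀ k j, gHull k j w 0 = 0 := fun w hw k j => by
    have hcl : IsClosed {w : C(ℝ × ℝ, Flux m → ℝ) | w (0, 0) (Sum.inl (k, j)) = 0} :=
      isClosed_eq (continuous_eval_component (0, 0) _) continuous_const
    exact hull_subset_of_isClosed hcl (fun r => h.2.2.2 k j (r + 0)) hw
  have hI : 0 ≤ inflow i w := by
    have hcl : IsClosed {w : C(ℝ × ℝ, Flux m → ℝ) | 0 ≤ w (0, 0) (Sum.inr i)} :=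
      isClosed_le continuous_const (continuous_eval_component (0, 0) _)
    exact hull_subset_of_isClosed hcl (fun r => S.inflow_nonneg i (r + 0) 0) hw
  have h0 : at0 (segment (0 : ℝ → Fin m → ℝ) t) i = 0 := by simp [at0, segment]
  have hs : ∀ s j, segment (0 : ℝ → Fin m → ℝ) t s j = 0 := by simp [segment]
  have hint : ∀ j, ∫ s : Iic (0 : ℝ), gHull (some i) j (translate (s : ℝ) w)
      (segment (0 : ℝ → Fin m → ℝ) t s j) ∂(S.μ i j) = 0 := fun j => by
    simp [hs, hz _ (translate_mem_hull hw _)]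
  simp only [F, h0, hz w hw, hint, Finset.sum_const_zero]
  linarith

theorem positivelyInvariant (h1 : S.C1) (h3 : S.C3) (h4 : S.C4) (h5 : S.C5) :
    PositivelyInvariant translate S.D S.F (S.Ω ×ˢ BUDPos S.D) := by
  rintro w x ⟨hw, hx, hpos⟩ b z hz T hT hTb
  have hi := hz.initial
  subst hi
  have hzc := hz.continuousOn_Iic hTb
  refine ⟨translate_mem_hull hw T, segment_mem_BU hT hzc hx, fun s i => ?_⟩
  have hs := s.2
  simp only [mem_Iic] at hs
  have hzero : ∀ r i, S.D (segment (0 : ℝ → Fin m → ℝ) r) i = 0 := D_segment_zero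
  -- The zero function need not be a solution. Since `F(ω·t, 0) ≥ 0`, the derivative `F(ω·t, z_t)`
  -- of `D z_t - 0` dominates `F(ω·t, z_t) - F(ω·t, 0)`, which is all that `comparison` asks for.
  have hcmp := (comparison h1 h3 h4 h5 hw hT (x := 0) (y := z) continuousOn_const hzc
    ⟨⟨0, by simp [segment]⟩, uniformContinuous_const⟩ hx
    (fun r j => by
      rw [shift_segment, hzero]
      exact hpos r j)
    (f := fun t => S.F (translate t w) (segment z t))
    (fun t ht j => by
      simpa only [hzero, sub_zero] using hz.hasDerivWithinAt_apply hTb ht j)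
    (fun t _ j => sub_le_self _ (h1.F_zero_nonneg (translate_mem_hull hw t) t j))).1
    (T + s) (by linarith) i
  rw [hzero] at hcmp
  rw [shift_segment]
  exact hcmp

end Compartmental

end NFDE

end

theorem mainTheorem12 {m : ℕ} (S : NFDE.Compartmental m)
    (h1 : S.C1) (h2 : S.C2) (h3 : S.C3) (h4 : S.C4) (h5 : S.C5) :
    NFDE.Quasimonotone S.Ω S.D S.F ∧
    NFDE.ComponentwiseSeparating S.Ω NFDE.translate S.D S.F ∧
    NFDE.PositivelyInvariant NFDE.translate S.D S.F (S.Ω ×ˢ NFDE.BUDPos S.D) :=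
  ⟨NFDE.Compartmental.quasimonotone h1 h3 h4 h5,
    NFDE.Compartmental.componentwiseSeparating h1 h3 h4 h5,
    NFDE.Compartmental.positivelyInvariant h1 h3 h4 h5⟩
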